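/- Let $G=(V,E)$ be a finite simple (not necessarily bipartite) graph and let $0<p\le 1$. A realization $G_p=(V,E_p)$ of $G$ is the random subgraph obtained by keeping each edge of $G$ independently with probability $p$. Let $\mathrm{OPT}$ be the expected number of edges of a maximum matching of $G_p$. For an integer $b\ge 1$, a simple $b$-matching of $G$ is a subgraph of $G$ in which every vertex has degree at most $b$; its size is its number of edges. Then $G$ contains a simple $\lfloor 1/p\rfloor$-matching with at least $(\lfloor 1/p\rfloor-1)\cdot\mathrm{OPT}$ edges. -/

import Mathlib

namespace StochasticMatching

/-- The law of a realization `G_p` of `G`: every edge of `G` is kept independently with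
probability `p`, and the vertex set is unchanged. -/
noncomputable def realization {V : Type*} (G : SimpleGraph V) (p : unitInterval) :
    MeasureTheory.Measure (SimpleGraph V) :=
  (ProbabilityTheory.setBernoulli G.edgeSet p).map SimpleGraph.fromEdgeSet

/-- The maximum number of edges of a matching of a (finite) graph. -/
noncomputable def matchingNumber {V : Type*} (G : SimpleGraph V) : ℕ :=
  sSup {n : ℕ | ∃ M : G.Subgraph, M.IsMatching ∧ M.edgeSet.ncard = n}

/-- The expected maximum matching size of a realization of `G`. -/
noncomputable def opt {V : Type*} (G : SimpleGraph V) (p : unitInterval) : ℝ :=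
  ∫ H, (matchingNumber H : ℝ) ∂(realization G p)

/-- `B` is a simple `b`-matching of `G`: a subgraph of `G` in which every vertex has degree
at most `b`. -/
def IsSimpleBMatching {V : Type*} (G : SimpleGraph V) (b : ℕ) (B : SimpleGraph V) : Prop :=
  B ≤ G ∧ ∀ v : V, (B.neighborSet v).encard ≤ b

/-- The realization law is a probability measure. -/
theorem isProbabilityMeasure_realization {V : Type*} [Finite V] (G : SimpleGraph V)
    (p : unitInterval) : MeasureTheory.IsProbabilityMeasure (realization G p) :=
  MeasureTheory.Measure.isProbabilityMeasure_map
    SimpleGraph.measurable_fromEdgeSet.aemeasurable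

/-- Every one-point set of graphs on a finite vertex set is measurable. -/
theorem measurableSingletonClass_simpleGraph {V : Type*} [Finite V] :
    MeasurableSingletonClass (SimpleGraph V) where
  measurableSet_singleton H := by
    have h : ({H} : Set (SimpleGraph V)) = SimpleGraph.edgeSet ⁻¹' {H.edgeSet} := by
      ext K; simp
    rw [h]
    exact SimpleGraph.measurableEmbedding_edgeSet.measurable (Set.toFinite _).measurableSet

/-- The integral that defines `opt` is a genuine expectation. -/
theorem integrable_matchingNumber {V : Type*} [Finite V] (G : SimpleGraph V)
    (p : unitInterval) :
    MeasureTheory.Integrable (fun H => (matchingNumber H : ℝ)) (realization G p) := by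
  have := isProbabilityMeasure_realization G p
  have := measurableSingletonClass_simpleGraph (V := V)
  exact MeasureTheory.Integrable.of_finite

/-- The supremum that defines `matchingNumber` is a maximum. -/
theorem isGreatest_matchingNumber {V : Type*} [Finite V] (G : SimpleGraph V) :
    IsGreatest {n : ℕ | ∃ M : G.Subgraph, M.IsMatching ∧ M.edgeSet.ncard = n}
      (matchingNumber G) := by
  have hne : {n : ℕ | ∃ M : G.Subgraph, M.IsMatching ∧ M.edgeSet.ncard = n}.Nonempty :=
    ⟨0, ⊥, by intro v hv; simp at hv, by simp⟩
  have hbd : BddAbove {n : ℕ | ∃ M : G.Subgraph, M.IsMatching ∧ M.edgeSet.ncard = n} := by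
    refine ⟨G.edgeSet.ncard, ?_⟩
    rintro n ⟨M, -, rfl⟩
    exact Set.ncard_le_ncard M.edgeSet_subset (Set.toFinite _)
  exact ⟨Nat.sSup_mem hne hbd, fun n hn => le_csSup hbd hn⟩

end StochasticMatching

/-! Fix a maximum matching of each realization and let `x e` be the probability that it contains
`e`. Then `x` is a fractional matching of weight OPT with `x e ≤ p` (`exists_fractional_matching`).
For `k = ⌊1/p⌋ - 1`, the vector `k * x` lies in the unit cube, has degrees at most `k` and weight `k
* OPT`. Iterated relaxation rounds it, losing one unit of degree and no weight
(`IsNearFeasible.exists_rounding`). Only vertices with more than `k + 1` nonzero edges need their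
constraint. Each meets at least three fractional edges, while an edge has at most two ends, so
constraints are fewer than fractional edges. Hence some nonzero direction preserves the constraints
without losing weight, and following it makes a fractional edge integral. -/

namespace StochasticMatching

open MeasureTheory ProbabilityTheory
open scoped Finset

/-! ### Rounding by iterated relaxation. -/

section Rounding

variable {V E : Type*} [Fintype V] [Fintype E] [DecidableEq E]

/-- A homogeneous linear system with more unknowns (indexed by `F`) than equations
(indexed by `W`) has a nonzero solution with nonnegative coordinate sum. -/
lemma exists_direction (inc : V → Finset E) (W : Finset V) (F : Finset E) (h : #W < #F) :
    ∃ d : E → ℝ, d ≠ 0 ∧ (∀ e ∉ F, d e = 0) ∧ (∀ v ∈ W, ∑ e ∈ inc v, d e = 0) ∧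
      0 ≤ ∑ e, d e := by
  suffices H : ∃ d : E → ℝ, d ≠ 0 ∧ (∀ e ∉ F, d e = 0) ∧ (∀ v ∈ W, ∑ e ∈ inc v, d e = 0) by
    obtain ⟨d, h0, hF, hW⟩ := H
    rcases le_total 0 (∑ e, d e) with hs | hs
    · exact ⟨d, h0, hF, hW, hs⟩
    · refine ⟨-d, neg_ne_zero.2 h0, fun e he => by simp [hF e he], fun v hv => ?_, ?_⟩
      · simp [hW v hv]
      · simpa using hs
  let ext : (F → ℝ) →ₗ[ℝ] (E → ℝ) :=
    LinearMap.pi fun e => if he : e ∈ F then LinearMap.proj ⟨e, he⟩ else 0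
  let f : (F → ℝ) →ₗ[ℝ] (W → ℝ) :=
    LinearMap.pi fun v => ∑ e ∈ inc v, LinearMap.proj e ∘ₗ ext
  have hker : LinearMap.ker f ≠ ⊥ := f.ker_ne_bot_of_finrank_lt (by simpa using h)
  obtain ⟨c, hc, hc0⟩ := (Submodule.ne_bot_iff _).1 hker
  have hext (e : E) (he : e ∈ F) : ext c e = c ⟨e, he⟩ := by simp [ext, he]
  refine ⟨ext c, fun h0 => hc0 ?_, fun e he => by simp [ext, he], fun v hv => ?_⟩
  · funext ⟨e, he⟩
    rw [← hext e he, h0]; rfl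
  · have := congrFun (LinearMap.mem_ker.1 hc) ⟨v, hv⟩
    simpa [f] using this

omit [DecidableEq E] in
/-- Moving from a point of the unit cube in a direction supported on its fractional coordinates,
one can stop inside the cube with some fractional coordinate having become integral. -/
lemma exists_step (y d : E → ℝ) (h0 : ∀ e, 0 ≤ y e) (h1 : ∀ e, y e ≤ 1) (hd : d ≠ 0)
    (hsupp : ∀ e, d e ≠ 0 → 0 < y e ∧ y e < 1) :
    ∃ t : ℝ, 0 ≤ t ∧ (∀ e, 0 ≤ y e + t * d e) ∧ (∀ e, y e + t * d e ≤ 1) ∧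
      ∃ e, (0 < y e ∧ y e < 1) ∧ (y e + t * d e = 0 ∨ y e + t * d e = 1) := by
  obtain ⟨e₀, he₀⟩ := Function.ne_iff.1 hd
  -- For `d e ≠ 0`, `g e` is the time at which coordinate `e` reaches the boundary of `[0, 1]`; the
  -- smallest such time is the step length.
  let g : E → ℝ := fun e => if 0 < d e then (1 - y e) / d e else y e / (-d e)
  obtain ⟨m, hm, hmin⟩ := Finset.exists_min_image {e | d e ≠ 0} g ⟨e₀, by simpa using he₀⟩
  simp only [Finset.mem_filter, Finset.mem_univ, true_and] at hm hmin
  have hg (e : E) (he : d e ≠ 0) : 0 ≤ g e := by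
    have := hsupp e he
    simp only [g]
    split_ifs with h
    · exact div_nonneg (by linarith) h.le
    · exact div_nonneg this.1.le (by linarith [not_lt.1 h])
  refine ⟨g m, hg m hm, fun e => ?_, fun e => ?_, m, hsupp m hm, ?_⟩
  · rcases lt_trichotomy (d e) 0 with h | h | h
    · have := hmin e h.ne
      rw [show g e = y e / (-d e) by simp [g, h.not_gt], le_div_iff₀ (by linarith)] at this
      linarith
    · simpa [h] using h0 e
    · have := mul_nonneg (hg m hm) h.le
      linarith [h0 e]
  · rcases lt_trichotomy (d e) 0 with h | h | h
    · have := mul_nonneg (hg m hm) (neg_nonneg.2 h.le)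
      linarith [h1 e]
    · simpa [h] using h1 e
    · have := hmin e h.ne'
      rw [show g e = (1 - y e) / d e by simp [g, h], le_div_iff₀ h] at this
      linarith
  · rcases lt_or_gt_of_ne hm with h | h
    · left
      rw [show g m = y m / (-d m) by simp [g, h.not_gt]]
      field_simp
      ring
    · right
      rw [show g m = (1 - y m) / d m by simp [g, h]]
      field_simp
      ring

/-- The relaxed degree condition maintained during the rounding: at every vertex the weight is at
most `k`, or at most `k + 1` incident edges carry weight at all. -/
structure IsNearFeasible (inc : V → Finset E) (k : ℕ) (y : E → ℝ) : Prop where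
  nonneg : ∀ e, 0 ≤ y e
  le_one : ∀ e, y e ≤ 1
  degree : ∀ v, ∑ e ∈ inc v, y e ≤ k ∨ #{e ∈ inc v | y e ≠ 0} ≤ k + 1

/-- The set of edges of fractional weight. -/
noncomputable def fractional (y : E → ℝ) : Finset E := {e | 0 < y e ∧ y e < 1}

omit [DecidableEq E] in
lemma mem_fractional {y : E → ℝ} {e : E} : e ∈ fractional y ↔ 0 < y e ∧ y e < 1 := by
  simp [fractional]

omit [Fintype V] in
/-- A vertex with more than `k + 1` weighted edges but weight at most `k` meets at least three
fractional edges. -/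
lemma IsNearFeasible.three_le_card {inc : V → Finset E} {k : ℕ} {y : E → ℝ}
    (hy : IsNearFeasible inc k y) {v : V} (hv : k + 1 < #{e ∈ inc v | y e ≠ 0}) :
    3 ≤ #(fractional y ∩ inc v) := by
  have hk : ∑ e ∈ inc v, y e ≤ k := (hy.degree v).resolve_right (by omega)
  set A : Finset E := {e ∈ inc v | y e = 1}
  set F := fractional y ∩ inc v
  have hdisj : Disjoint A F := by
    rw [Finset.disjoint_left]
    intro e he he'
    have h1 := (Finset.mem_filter.1 he).2
    have h2 := (mem_fractional.1 (Finset.mem_inter.1 he').1).2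
    linarith
  have hunion : ({e ∈ inc v | y e ≠ 0} : Finset E) = A ∪ F := by
    ext e
    simp only [Finset.mem_filter, Finset.mem_union, A, F, Finset.mem_inter, mem_fractional]
    have h0 := hy.nonneg e
    have h1 := hy.le_one e
    constructor
    · rintro ⟨hi, hne⟩
      rcases h1.eq_or_lt with h | h
      · exact Or.inl ⟨hi, h⟩
      · exact Or.inr ⟨⟨lt_of_le_of_ne h0 (Ne.symm hne), h⟩, hi⟩
    · rintro (⟨hi, h⟩ | ⟨⟨h, -⟩, hi⟩)
      · exact ⟨hi, by rw [h]; exact one_ne_zero⟩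
      · exact ⟨hi, h.ne'⟩
  have hcard : k + 1 < #A + #F := by
    rw [← Finset.card_union_of_disjoint hdisj, ← hunion]; exact hv
  have hsum : (#A : ℝ) + ∑ e ∈ F, y e ≤ k := by
    have hA : ∑ e ∈ A, y e = #A := by
      rw [Finset.sum_congr rfl fun e he => (Finset.mem_filter.1 he).2, Finset.sum_const, nsmul_one]
    rw [← hA, ← Finset.sum_union hdisj, ← hunion]
    exact (Finset.sum_le_sum_of_subset_of_nonneg (Finset.filter_subset _ _)
      fun e _ _ => hy.nonneg e).trans hk
  rcases F.eq_empty_or_nonempty with h | h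
  · simp only [h, Finset.card_empty, Finset.sum_empty, add_zero] at hcard hsum
    have : #A ≤ k := by exact_mod_cast hsum
    omega
  -- The fractional edges use up positive weight, so at most `k - 1` edges have weight one, and at
  -- least three of the `k + 2` or more nonzero edges are fractional.
  · have hpos : 0 < ∑ e ∈ F, y e :=
      Finset.sum_pos (fun e he => (mem_fractional.1 (Finset.mem_inter.1 he).1).1) h
    have : #A < k := by exact_mod_cast (by linarith : (#A : ℝ) < k)
    omega

/-- As long as some edge is fractional, the number of fractional edges can be decreased without
decreasing the total weight. -/
lemma IsNearFeasible.exists_fewer_fractional [DecidableEq V] {inc : V → Finset E}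
    (hinc : ∀ e, #{v | e ∈ inc v} ≤ 2) {k : ℕ} {y : E → ℝ} (hy : IsNearFeasible inc k y)
    (hF : (fractional y).Nonempty) :
    ∃ z : E → ℝ, IsNearFeasible inc k z ∧ (∀ e, y e = 0 → z e = 0) ∧
      #(fractional z) < #(fractional y) ∧ ∑ e, y e ≤ ∑ e, z e := by
  set W : Finset V := {v | k + 1 < #{e ∈ inc v | y e ≠ 0}} with hW
  have hcard : #W < #(fractional y) := by
    -- Double counting incidences between `W` and the fractional edges gives `3 * #W ≤ 2 *
    -- #(fractional y)`.
    have h1 : #W * 3 ≤ ∑ v ∈ W, #(fractional y ∩ inc v) := by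
      rw [← smul_eq_mul]
      exact Finset.card_nsmul_le_sum _ _ _ fun v hv =>
        hy.three_le_card (Finset.mem_filter.1 hv).2
    have h2 : ∑ v ∈ W, #(fractional y ∩ inc v) ≤ #(fractional y) * 2 := by
      calc ∑ v ∈ W, #(fractional y ∩ inc v)
          = ∑ v ∈ W, ∑ e ∈ fractional y, if e ∈ inc v then 1 else 0 := by
            refine Finset.sum_congr rfl fun v _ => ?_
            rw [Finset.sum_boole, Finset.filter_mem_eq_inter, Nat.cast_id]
        _ = ∑ e ∈ fractional y, ∑ v ∈ W, if e ∈ inc v then 1 else 0 := Finset.sum_comm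
        _ ≤ ∑ e ∈ fractional y, 2 := by
            refine Finset.sum_le_sum fun e _ => ?_
            rw [Finset.sum_boole, Nat.cast_id]
            exact (Finset.card_le_card (Finset.filter_subset_filter _
              (Finset.subset_univ _))).trans (hinc e)
        _ = #(fractional y) * 2 := by simp
    have := hF.card_pos
    omega
  obtain ⟨d, hd0, hdF, hdW, hds⟩ := exists_direction inc W (fractional y) hcard
  have hsupp (e : E) (he : d e ≠ 0) : 0 < y e ∧ y e < 1 :=
    mem_fractional.1 (by_contra fun h => he (hdF e h))
  obtain ⟨t, ht, ht0, ht1, e₀, he₀, hint⟩ := exists_step y d hy.nonneg hy.le_one hd0 hsupp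
  have hfix (e : E) (he : e ∉ fractional y) : y e + t * d e = y e := by simp [hdF e he]
  have hzero (e : E) (he : y e = 0) : y e + t * d e = 0 := by
    rw [hfix e (by simp [mem_fractional, he]), he]
  refine ⟨fun e => y e + t * d e, ⟨ht0, ht1, fun v => ?_⟩, hzero, ?_, ?_⟩
  · by_cases hv : v ∈ W
    · left
      rw [Finset.sum_add_distrib, ← Finset.mul_sum, hdW v hv, mul_zero, add_zero]
      exact (hy.degree v).resolve_right (not_le.2 (Finset.mem_filter.1 hv).2)
    -- A dropped constraint never has to return: zero coordinates stay zero, so the number of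
    -- nonzero edges at `v` cannot grow.
    · right
      have hv' : #{e ∈ inc v | y e ≠ 0} ≤ k + 1 := by simpa [hW] using hv
      refine (Finset.card_le_card fun e he => ?_).trans hv'
      rw [Finset.mem_filter] at he ⊢
      exact ⟨he.1, fun h => he.2 (hzero e h)⟩
  · refine Finset.card_lt_card (Finset.ssubset_iff_subset_ne.2 ⟨fun e he => ?_, fun h => ?_⟩)
    · by_contra hne
      rw [mem_fractional, hfix e hne] at he
      exact hne (mem_fractional.2 he)
    · have := mem_fractional.1 (h ▸ mem_fractional.2 he₀ :
        e₀ ∈ fractional fun e => y e + t * d e)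
      rcases hint with h' | h' <;> linarith [this.1, this.2]
  · rw [Finset.sum_add_distrib, ← Finset.mul_sum]
    linarith [mul_nonneg ht hds]

/-- A fractional solution of the degree constraints `≤ k` rounds to a set of edges with degrees
`≤ k + 1` and at least the same total weight. -/
lemma IsNearFeasible.exists_rounding [DecidableEq V] {inc : V → Finset E}
    (hinc : ∀ e, #{v | e ∈ inc v} ≤ 2) {k : ℕ} {y : E → ℝ} (hy : IsNearFeasible inc k y) :
    ∃ S : Finset E, (∀ e ∈ S, y e ≠ 0) ∧ (∀ v, #(S ∩ inc v) ≤ k + 1) ∧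
      ∑ e, y e ≤ #S := by
  induction hn : #(fractional y) using Nat.strong_induction_on generalizing y with
  | _ n ih =>
    rcases (fractional y).eq_empty_or_nonempty with hF | hF
    · have hint (e : E) : y e = if y e ≠ 0 then 1 else 0 := by
        have h : e ∉ fractional y := by simp [hF]
        rw [mem_fractional, not_and, not_lt] at h
        split_ifs with h0
        · exact le_antisymm (hy.le_one e) (h (lt_of_le_of_ne (hy.nonneg e) (Ne.symm h0)))
        · exact not_not.1 h0
      refine ⟨({e | y e ≠ 0} : Finset E), fun e he => (Finset.mem_filter.1 he).2,
        fun v => ?_, ?_⟩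
      · have hset : ({e | y e ≠ 0} : Finset E) ∩ inc v = {e ∈ inc v | y e ≠ 0} := by
          ext e; simp [and_comm]
        rw [hset]
        rcases hy.degree v with h | h
        · rw [Finset.sum_congr rfl fun e _ => hint e, Finset.sum_boole] at h
          have : #{e ∈ inc v | y e ≠ 0} ≤ k := by exact_mod_cast h
          omega
        · exact h
      · rw [Finset.sum_congr rfl fun e _ => hint e, Finset.sum_boole]
    · obtain ⟨z, hz, hsupp, hlt, hsum⟩ := hy.exists_fewer_fractional hinc hF
      obtain ⟨S, hS, hdeg, hS'⟩ := ih _ (hn ▸ hlt) hz rfl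
      exact ⟨S, fun e he h => hS e he (hsupp e h), hdeg, hsum.trans hS'⟩

end Rounding

/-! ### Edge probabilities in a realization. -/

section Realization

variable {V : Type*} [Finite V]

lemma measurableSet_simpleGraph (s : Set (SimpleGraph V)) : MeasurableSet s :=
  have := measurableSingletonClass_simpleGraph (V := V)
  s.toFinite.measurableSet

open scoped Classical in
/-- A realization contains a given edge of `G` with probability at most `p`, and no other edge. -/
lemma realization_real_mem_edgeSet_le (G : SimpleGraph V) (p : unitInterval) (e : Sym2 V) :
    (realization G p).real {H | e ∈ H.edgeSet} ≤ if e ∈ G.edgeSet then (p : ℝ) else 0 := by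
  classical
  have hle : (realization G p).real {H | e ∈ H.edgeSet} ≤
      (setBernoulli G.edgeSet p).real {s | e ∈ s} := by
    rw [realization, map_measureReal_apply SimpleGraph.measurable_fromEdgeSet
      (measurableSet_simpleGraph _)]
    refine measureReal_mono fun s hs => ?_
    simp only [Set.mem_preimage, Set.mem_ofPred_eq, SimpleGraph.edgeSet_fromEdgeSet] at hs
    exact hs.1
  refine hle.trans_eq ?_
  -- The event depends on a single coordinate of the product measure behind `setBernoulli`.
  have hset : ((fun q : Sym2 V → Prop => {i | q i}) ⁻¹' {s | e ∈ s}) =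
      cylinder {e} ({fun _ => True} : Set (({e} : Finset (Sym2 V)) → Prop)) := by
    ext; simp [funext_iff]
  rw [measureReal_def, setBernoulli_apply', hset]
  split_ifs with h <;> simp [Measure.infinitePi_cylinder, h]

/-- The sum of the probabilities of finitely many events is the expected number of events that
occur. -/
lemma sum_measureReal_eq_integral_card {E : Type*} (G : SimpleGraph V) (p : unitInterval)
    (s : Finset E) (A : E → SimpleGraph V → Prop) [∀ e H, Decidable (A e H)] :
    ∑ e ∈ s, (realization G p).real {H | A e H} =
      ∫ H, (#{e ∈ s | A e H} : ℝ) ∂(realization G p) := by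
  have := isProbabilityMeasure_realization G p
  have := measurableSingletonClass_simpleGraph (V := V)
  calc ∑ e ∈ s, (realization G p).real {H | A e H}
      = ∑ e ∈ s, ∫ H, (if A e H then (1 : ℝ) else 0) ∂(realization G p) := by
        refine Finset.sum_congr rfl fun e _ => ?_
        rw [← integral_indicator_one (measurableSet_simpleGraph _)]
        refine integral_congr_ae (Filter.Eventually.of_forall fun H => ?_)
        simp [Set.indicator_apply]
    _ = ∫ H, ∑ e ∈ s, (if A e H then (1 : ℝ) else 0) ∂(realization G p) :=
        (integral_finsetSum _ fun e _ => Integrable.of_finite).symm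
    _ = _ := by simp only [Finset.sum_boole]

end Realization

/-- A matching contains at most one edge at each vertex. -/
lemma card_incident_le_one {V : Type*} [Fintype V] [DecidableEq V] {H : SimpleGraph V}
    {M : H.Subgraph} (hM : M.IsMatching) (v : V) [DecidablePred (· ∈ M.edgeSet)] :
    #{e ∈ ({e | v ∈ e} : Finset (Sym2 V)) | e ∈ M.edgeSet} ≤ 1 := by
  rw [Finset.card_le_one]
  intro a ha b hb
  simp only [Finset.mem_filter, Finset.mem_univ, true_and] at ha hb
  obtain ⟨⟨u, rfl⟩, ha⟩ := ha
  obtain ⟨⟨w, rfl⟩, hb⟩ := hb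
  rw [SimpleGraph.Subgraph.mem_edgeSet] at ha hb
  rw [hM.eq_of_adj_left ha hb]

/-- The probabilities with which the edges belong to a maximum matching of the realization form
a fractional matching of weight `opt G p`. -/
lemma exists_fractional_matching {V : Type*} [Fintype V] [DecidableEq V] (G : SimpleGraph V)
    (p : unitInterval) :
    ∃ x : Sym2 V → ℝ, (∀ e, 0 ≤ x e) ∧ (∀ e, x e ≤ p) ∧ (∀ e ∉ G.edgeSet, x e = 0) ∧
      (∀ v, ∑ e : Sym2 V with v ∈ e, x e ≤ 1) ∧ ∑ e, x e = opt G p := by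
  classical
  have := isProbabilityMeasure_realization G p
  have := measurableSingletonClass_simpleGraph (V := V)
  choose M hM hcard using fun H : SimpleGraph V => (isGreatest_matchingNumber H).1
  have hle (e : Sym2 V) : (realization G p).real {H | e ∈ (M H).edgeSet} ≤
      if e ∈ G.edgeSet then (p : ℝ) else 0 :=
    (measureReal_mono fun H h => (M H).edgeSet_subset h).trans
      (realization_real_mem_edgeSet_le G p e)
  refine ⟨fun e => (realization G p).real {H | e ∈ (M H).edgeSet}, fun e => measureReal_nonneg,
    fun e => (hle e).trans ?_, fun e he => ?_, fun v => ?_, ?_⟩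
  · split_ifs
    · exact le_rfl
    · exact p.2.1
  · exact le_antisymm (by simpa [he] using hle e) measureReal_nonneg
  · rw [sum_measureReal_eq_integral_card G p _ fun e H => e ∈ (M H).edgeSet]
    calc _ ≤ ∫ _, (1 : ℝ) ∂(realization G p) :=
          integral_mono Integrable.of_finite Integrable.of_finite fun H => 
            Nat.cast_le_one.2 (card_incident_le_one (hM H) v)
      _ = 1 := by simp
  · rw [sum_measureReal_eq_integral_card G p _ fun e H => e ∈ (M H).edgeSet, opt]
    refine integral_congr_ae (Filter.Eventually.of_forall fun H => ?_)
    simp only [← hcard H]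
    rw [← Set.ncard_coe_finset]
    simp

/-- A set of edges of `G` with degrees at most `b` spans a simple `b`-matching. -/
lemma isSimpleBMatching_fromEdgeSet {V : Type*} [Fintype V] [DecidableEq V]
    {G : SimpleGraph V} {S : Finset (Sym2 V)} (hS : ∀ e ∈ S, e ∈ G.edgeSet) {b : ℕ}
    (hdeg : ∀ v, #(S ∩ ({e | v ∈ e} : Finset (Sym2 V))) ≤ b) :
    IsSimpleBMatching G b (SimpleGraph.fromEdgeSet (S : Set (Sym2 V))) := by
  refine ⟨fun u v h => hS _ (by simpa using h.1), fun v => ?_⟩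
  have hinj : Set.InjOn (fun w => s(v, w))
      ((SimpleGraph.fromEdgeSet (S : Set (Sym2 V))).neighborSet v) :=
    fun a _ c _ h => Sym2.congr_right.1 h
  rw [← hinj.encard_image]
  refine (Set.encard_le_encard
    (t := ((S ∩ ({e | v ∈ e} : Finset (Sym2 V)) : Finset (Sym2 V)) : Set (Sym2 V))) ?_).trans ?_
  · rintro _ ⟨w, hw, rfl⟩
    have := hw.1
    simpa using this
  · rw [Set.encard_coe_eq_coe_finsetCard]
    exact_mod_cast hdeg v

end StochasticMatching

theorem mainTheorem2 {V : Type*} [Finite V] (G : SimpleGraph V) (p : unitInterval) (hp : 0 < p) :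
    ∃ B : SimpleGraph V,
      StochasticMatching.IsSimpleBMatching G ⌊1 / (p : ℝ)⌋₊ B ∧
      ((⌊1 / (p : ℝ)⌋₊ : ℝ) - 1) * StochasticMatching.opt G p ≤ (B.edgeSet.ncard : ℝ) := by
  classical
  cases nonempty_fintype V
  have hp0 : (0 : ℝ) < p := hp
  have hb : 1 ≤ ⌊1 / (p : ℝ)⌋₊ := Nat.le_floor (by
    rw [Nat.cast_one, le_div_iff₀ hp0, one_mul]; exact p.2.2)
  -- Scaling by one less than `⌊1/p⌋` leaves room for the extra unit of degree that rounding costs.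
  obtain ⟨k, hk⟩ := Nat.exists_eq_add_of_le' hb
  have hkp : (k : ℝ) * p ≤ 1 := by
    have h := Nat.floor_le (div_nonneg zero_le_one hp0.le)
    rw [hk, le_div_iff₀ hp0] at h
    push_cast at h
    linarith
  obtain ⟨x, hx0, hxp, hxG, hxd, hxs⟩ := StochasticMatching.exists_fractional_matching G p
  have hy : StochasticMatching.IsNearFeasible
      (fun v : V => ({e | v ∈ e} : Finset (Sym2 V))) k (fun e => k * x e) :=
    { nonneg := fun e => mul_nonneg k.cast_nonneg (hx0 e)
      le_one := fun e => (mul_le_mul_of_nonneg_left (hxp e) k.cast_nonneg).trans hkp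
      degree := fun v => Or.inl (by
        rw [← Finset.mul_sum]
        exact mul_le_of_le_one_right k.cast_nonneg (hxd v)) }
  -- The rounding runs over all of `Sym2 V`, loops included; these have one end, and weight zero
  -- since they are not edges of `G`.
  have hinc (e : Sym2 V) :
      ({v | e ∈ ({e | v ∈ e} : Finset (Sym2 V))} : Finset V).card ≤ 2 := by
    have : ({v | e ∈ ({e | v ∈ e} : Finset (Sym2 V))} : Finset V) = e.toFinset := by
      ext v; simp
    rw [this, Sym2.card_toFinset]
    split_ifs <;> omega
  obtain ⟨S, hS, hdeg, hsum⟩ := hy.exists_rounding hinc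
  have hSG : ∀ e ∈ S, e ∈ G.edgeSet := fun e he => by
    by_contra h
    exact hS e he (by simp [hxG e h])
  refine ⟨SimpleGraph.fromEdgeSet (S : Set (Sym2 V)), ?_, ?_⟩
  · rw [hk]
    exact StochasticMatching.isSimpleBMatching_fromEdgeSet hSG hdeg
  · have hedge : (SimpleGraph.fromEdgeSet (S : Set (Sym2 V))).edgeSet = S := by
      rw [SimpleGraph.edgeSet_fromEdgeSet, sdiff_eq_left, Set.disjoint_left]
      exact fun e he => G.not_isDiag_of_mem_edgeSet (hSG e he)
    rw [hedge, Set.ncard_coe_finset, hk, ← hxs]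
    rw [← Finset.mul_sum] at hsum
    push_cast
    linarith
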